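/- Let $G$ be a finite group, $H$ a normal subgroup of $G$, and let $V=\mathbb{R}^X$ and $Z=\mathbb{R}^Y$ be permutation representations of $G$, where $X,Y$ are finite $G$-sets and $g e_x=e_{gx}$. Let $\sigma:\mathbb{R}\to\mathbb{R}$ be continuous and not a polynomial, acting coordinatewise. Let $W=\mathbb{R}^{G/H}$, with $G$ permuting the cosets by left multiplication, and let $\mathrm{Aff}_G$ denote the space of $G$-equivariant affine maps. Let $\mathcal{U}(V,W,Z)$ be the closure, in the space $\mathcal{C}(V,Z)$ of continuous maps with the topology of uniform convergence on compact sets, of the set of all shallow networks $$v\mapsto \sum_{i=1}^h g_i\bigl(\sigma(f_i(v))\bigr),\qquad h\in\mathbb{N},\ f_i\in \mathrm{Aff}_G(V,W),\ g_i\in\mathrm{Aff}_G(W,Z).$$ Let $\rho$ be the set of pairs $(\alpha,\beta)\in V\times V$ such that $f(\alpha)=f(\beta)$ for all $f\in\mathcal{U}(V,W,Z)$. Then $\mathcal{U}(V,W,Z)$ is separation-constrained universal among continuous equivariant maps, that is, $$\mathcal{U}(V,W,Z)=\{f\in\mathcal{C}(V,Z)\mid f \text{ is } G\text{-equivariant and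 } f(\alpha)=f(\beta)\text{ for all }(\alpha,\beta)\in\rho\}.$$ In particular, if $G$ acts trivially on $Y$ (invariant networks), then $$\mathcal{U}(V,W,Z)=\{f\in\mathcal{C}(V,Z)\mid f(\alpha)=f(\beta)\text{ for all }(\alpha,\beta)\in\rho\}.$$ -/

import Mathlib

namespace EquivNet

/-- The permutation representation of `G` on `ℝ^X`, the real functions on a `G`-set `X`. -/
def permRep (G X : Type*) [Group G] [MulAction G X] : Representation ℝ G (X → ℝ) where
  toFun g :=
    { toFun := fun v x => v (g⁻¹ • x)
      map_add' := fun _ _ => rfl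
      map_smul' := fun _ _ => rfl }
  map_one' := by ext v x; simp
  map_mul' g k := by ext v x; simp [mul_smul]

/-- The defining property `g e_x = e_{g x}` of a permutation representation. -/
theorem permRep_single {G X : Type*} [Group G] [MulAction G X] [DecidableEq X] (g : G) (x : X) :
    permRep G X g (Pi.single x 1) = Pi.single (g • x) 1 := by
  funext y
  change (Pi.single x 1 : X → ℝ) (g⁻¹ • y) = _
  simp only [Pi.single_apply, inv_smul_eq_iff]

/-- `Aff_G(ℝ^X, ℝ^Y)`: the space of `G`-equivariant affine maps. -/
def affEquiv (G X Y : Type*) [Group G] [MulAction G X] [MulAction G Y] :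
    Submodule ℝ ((X → ℝ) →ᵃ[ℝ] (Y → ℝ)) where
  carrier := {f | ∀ (g : G) (v : X → ℝ), f (permRep G X g v) = permRep G Y g (f v)}
  add_mem' := by
    intro a b ha hb g v
    simp [ha g v, hb g v]
  zero_mem' := by
    intro g v
    simp
  smul_mem' := by
    intro c a ha g v
    simp [ha g v]

/-- The point-wise activation `ℝ^X → ℝ^X` attached to `σ : ℝ → ℝ`. -/
def pointwise {X : Type*} (σ : ℝ → ℝ) (v : X → ℝ) : X → ℝ := fun x => σ (v x)

/-- The neural space `N_σ(M, N)` with two layers: all maps `φ ∘ σ ∘ η` with `η ∈ M`, `φ ∈ N`. -/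
def neuralSpace {X Y Z : Type*} (σ : ℝ → ℝ) (M : Set ((X → ℝ) →ᵃ[ℝ] (Y → ℝ)))
    (N : Set ((Y → ℝ) →ᵃ[ℝ] (Z → ℝ))) : Set ((X → ℝ) → (Z → ℝ)) :=
  {F | ∃ η ∈ M, ∃ φ ∈ N, F = fun v => φ (pointwise σ (η v))}

/-- `M_h`: the maps `v ↦ (f_1 v, …, f_h v)` into `W ⊗ ℝ^h`, `W = ℝ^Y`, with all `f_i ∈ M`.
Here `ℝ^Y ⊗ ℝ^h` is `ℝ^(Y × [h])`. -/
def widenOut {X Y : Type*} (M : Submodule ℝ ((X → ℝ) →ᵃ[ℝ] (Y → ℝ))) (h : ℕ) :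
    Set ((X → ℝ) →ᵃ[ℝ] (Y × Fin h → ℝ)) :=
  {F | ∃ f : Fin h → ((X → ℝ) →ᵃ[ℝ] (Y → ℝ)),
    (∀ i, f i ∈ M) ∧ ∀ v y i, F v (y, i) = f i v y}

/-- `_h N`: the maps `(w_1, …, w_h) ↦ g_1 w_1 + ⋯ + g_h w_h` on `W ⊗ ℝ^h`, with all `g_i ∈ N`. -/
def widenIn {Y Z : Type*} (N : Submodule ℝ ((Y → ℝ) →ᵃ[ℝ] (Z → ℝ))) (h : ℕ) :
    Set ((Y × Fin h → ℝ) →ᵃ[ℝ] (Z → ℝ)) :=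
  {F | ∃ g : Fin h → ((Y → ℝ) →ᵃ[ℝ] (Z → ℝ)),
    (∀ i, g i ∈ N) ∧ ∀ w, F w = ∑ i, g i (fun y => w (y, i))}

/-- The universality class `U(M, N)`: the closure of `⋃ h, N_σ(M_h, _h N)` in the space of
continuous maps. The topology of `C(_, _)` is the compact-open one, that is, uniform convergence
on compact sets. -/
def universalityClass {X Y Z : Type*} (σ : ℝ → ℝ)
    (M : Submodule ℝ ((X → ℝ) →ᵃ[ℝ] (Y → ℝ))) (N : Submodule ℝ ((Y → ℝ) →ᵃ[ℝ] (Z → ℝ))) :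
    Set C(X → ℝ, Z → ℝ) :=
  closure {F | ∃ h : ℕ, (F : (X → ℝ) → (Z → ℝ)) ∈ neuralSpace σ (widenOut M h) (widenIn N h)}

/-- `U(ℝ^X, ℝ^Y, ℝ^Z)`: the universality class with all equivariant affine layers. -/
def fullUniversalityClass (G X Y Z : Type*) [Group G] [MulAction G X] [MulAction G Y]
    [MulAction G Z] (σ : ℝ → ℝ) : Set C(X → ℝ, Z → ℝ) :=
  universalityClass σ (affEquiv G X Y) (affEquiv G Y Z)

/-- `C_G(ℝ^X, ℝ^Z)`: the continuous `G`-equivariant maps. -/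
def continuousEquivariant (G X Z : Type*) [Group G] [MulAction G X] [MulAction G Z] :
    Set C(X → ℝ, Z → ℝ) :=
  {f | ∀ (g : G) (v : X → ℝ), f (permRep G X g v) = permRep G Z g (f v)}

/-- The relation `ρ(N)`: the pairs of points that no member of `N` separates. -/
def separationRel {A B : Type*} [TopologicalSpace A] [TopologicalSpace B] (N : Set C(A, B)) :
    Set (A × A) :=
  {p | ∀ f ∈ N, f p.1 = f p.2}

/-- The family `N` is separation-constrained universal within the class `K` of continuous maps:
its closure consists of all maps in `K` that respect the relation `ρ(N)`. -/
def IsSeparationConstrainedUniversal {A B : Type*} [TopologicalSpace A] [TopologicalSpace B]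
    (K N : Set C(A, B)) : Prop :=
  closure N = {f | f ∈ K ∧ ∀ p ∈ separationRel N, f p.1 = f p.2}

end EquivNet

/-! Because `H` is normal, it acts trivially on `ℝ^(G/H)`. Every network therefore factors through
the average over `H`, and so does every limit of networks. Hence each pair (average of `v`, `v`)
lies in ρ, and a map respecting ρ is unchanged by averaging. The theorem thus reduces to
`mem_fullUniversalityClass`: every continuous equivariant map with that property is a limit of
networks.

Its proof reduces to scalar functions. `symmetrize H y` is continuous and linear, and it carries a
ridge function `σ (l + b)` to an equivariant network (`symmetrize_ridge_mem`). Applied to the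
coordinates of `f` and summed over `y`, it returns `|G| • f` (`sum_symmetrize`). So it suffices that
scalar ridge functions are dense (`topologicalClosure_span_ridge_eq_top`).

For that density, let `L` be the quotient map by the closed span of the ridge functions on a compact
set. `L` also kills ridges of mollifications of `σ`; differentiating these in the scale of `u` gives
`L (u ^ n) = 0`, since a non-polynomial `σ` has, for every `n`, a mollification whose `n`-th
derivative is not identically zero. Summing the exponential series gives `L (exp u) = 0`, and
Stone–Weierstrass forces `L = 0`. -/

namespace EquivNet

/-! ### Non-polynomial activations and their mollifications. -/

section Universality

open MeasureTheory Filter Topology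

/-- Every real polynomial of degree `< n` has an antiderivative of degree `< n + 1`. -/
theorem exists_polynomial_derivative_eq {n : ℕ} {p : Polynomial ℝ} (hp : p.degree < n) :
    ∃ q : Polynomial ℝ, q.degree < (n + 1 : ℕ) ∧ q.derivative = p := by
  refine ⟨∑ i ∈ Finset.range n, Polynomial.monomial (i + 1) (p.coeff i / (i + 1)), ?_, ?_⟩
  · refine (Polynomial.degree_lt_iff_coeff_zero _ _).2 fun m hm => ?_
    rw [Polynomial.finsetSum_coeff]
    refine Finset.sum_eq_zero fun i hi => Polynomial.coeff_monomial_of_ne _ ?_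
    have := Finset.mem_range.1 hi
    lia
  · rw [Polynomial.derivative_sum]
    have hsum : p = ∑ i ∈ Finset.range n, Polynomial.monomial i (p.coeff i) := by
      ext m
      simp only [Polynomial.finsetSum_coeff, Polynomial.coeff_monomial, Finset.sum_ite_eq',
        Finset.mem_range]
      split_ifs with hm
      · rfl
      · exact Polynomial.coeff_eq_zero_of_degree_lt (hp.trans_le (by exact_mod_cast not_lt.1 hm))
    conv_rhs => rw [hsum]
    refine Finset.sum_congr rfl fun i _ => ?_
    rw [Polynomial.derivative_monomial, Nat.add_sub_cancel]
    congr 1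
    push_cast
    field_simp

/-- A smooth function with vanishing `n`-th derivative is a polynomial of degree `< n`. -/
theorem exists_polynomial_of_iteratedDeriv_eq_zero (n : ℕ) :
    ∀ {f : ℝ → ℝ}, ContDiff ℝ n f → (∀ x, iteratedDeriv n f x = 0) →
      ∃ p : Polynomial ℝ, p.degree < n ∧ ∀ x, f x = p.eval x := by
  induction n with
  | zero =>
    intro f _ h
    exact ⟨0, by simp, fun x => by simpa using h x⟩
  | succ n ih =>
    intro f hf h
    have hf' : ContDiff ℝ n (deriv f) := by
      have : ContDiff ℝ ((n : WithTop ℕ∞) + 1) f := by exact_mod_cast hf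
      exact (contDiff_succ_iff_deriv.1 this).2.2
    obtain ⟨p, hp, hpf⟩ := ih hf' fun x => by rw [← iteratedDeriv_succ']; exact h x
    obtain ⟨q, hq, rfl⟩ := exists_polynomial_derivative_eq hp
    have hfd : Differentiable ℝ f := hf.differentiable (by simp)
    have hconst : ∀ x, f x - q.eval x = f 0 - q.eval 0 := fun x =>
      is_const_of_deriv_eq_zero (f := fun x => f x - q.eval x) (hfd.sub q.differentiable)
        (fun y => by
          have := ((hfd y).hasDerivAt.sub (q.hasDerivAt y)).deriv
          rw [show (fun x => f x - q.eval x) = f - fun x => q.eval x from rfl, this, hpf y,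
            sub_self])
        x 0
    refine ⟨q + Polynomial.C (f 0 - q.eval 0), ?_, fun x => ?_⟩
    · refine (Polynomial.degree_add_le _ _).trans_lt (max_lt hq (Polynomial.degree_C_le.trans_lt ?_))
      exact_mod_cast n.succ_pos
    · simp only [Polynomial.eval_add, Polynomial.eval_C, ← hconst x]
      ring

/-- A pointwise limit of polynomials of bounded degree is a polynomial. -/
theorem exists_polynomial_of_tendsto {n : ℕ} {p : ℕ → Polynomial ℝ} (hp : ∀ k, (p k).degree < n)
    {f : ℝ → ℝ} (hf : ∀ x, Tendsto (fun k => (p k).eval x) atTop (𝓝 (f x))) :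
    ∃ q : Polynomial ℝ, ∀ x, f x = q.eval x := by
  let s := Finset.range n
  let v : ℕ → ℝ := fun i => i
  have hv : Set.InjOn v s := Nat.cast_injective.injOn
  -- The bounded degree makes each `p k` a fixed linear function of its values at the nodes `0, …, n
  -- - 1`, so convergence at the nodes determines the limit.
  refine ⟨Lagrange.interpolate s v fun i => f (v i), fun x => tendsto_nhds_unique (hf x) ?_⟩
  have key : ∀ k, (p k).eval x = ∑ i ∈ s, (p k).eval (v i) * (Lagrange.basis s v i).eval x := by
    intro k
    conv_lhs => rw [Lagrange.eq_interpolate hv (f := p k) (by simpa [s] using hp k)]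
    simp [Lagrange.interpolate_apply, Polynomial.eval_finsetSum]
  simp only [key, Lagrange.interpolate_apply, Polynomial.eval_finsetSum, Polynomial.eval_mul,
    Polynomial.eval_C]
  exact tendsto_finsetSum _ fun i _ => (hf (v i)).mul_const _

/-- The mollification of `σ` by a smooth bump function. -/
noncomputable def mollify (φ : ContDiffBump (0 : ℝ)) (σ : ℝ → ℝ) : ℝ → ℝ :=
  convolution (φ.normed volume) σ (ContinuousLinearMap.lsmul ℝ ℝ) volume

theorem contDiff_mollify (φ : ContDiffBump (0 : ℝ)) {σ : ℝ → ℝ} (hσ : Continuous σ) (n : ℕ) :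
    ContDiff ℝ n (mollify φ σ) := by
  exact_mod_cast φ.hasCompactSupport_normed.contDiff_convolution_left (n := n)
    (ContinuousLinearMap.lsmul ℝ ℝ) φ.contDiff_normed hσ.locallyIntegrable

/-- If `σ` is not a polynomial, then some mollification of `σ` has a non-zero `n`-th derivative. -/
theorem exists_iteratedDeriv_mollify_ne_zero {σ : ℝ → ℝ} (hσ : Continuous σ)
    (hpoly : ¬ ∃ p : Polynomial ℝ, ∀ t : ℝ, σ t = p.eval t) (n : ℕ) :
    ∃ (φ : ContDiffBump (0 : ℝ)) (b : ℝ), iteratedDeriv n (mollify φ σ) b ≠ 0 := by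
  by_contra! h
  choose p hp hpφ using fun φ =>
    exists_polynomial_of_iteratedDeriv_eq_zero n (contDiff_mollify φ hσ n) (h φ)
  -- Bumps of outer radius `1 / (k + 1)`: their mollifications converge pointwise to `σ`, and all
  -- have degree below the same `n`.
  let φ : ℕ → ContDiffBump (0 : ℝ) := fun k =>
    ⟨1 / ((k : ℝ) + 1) / 2, 1 / ((k : ℝ) + 1), by positivity, half_lt_self (by positivity)⟩
  refine hpoly (exists_polynomial_of_tendsto (fun k => hp (φ k)) fun x => ?_)
  simp only [← hpφ]
  exact ContDiffBump.convolution_tendsto_right_of_continuous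
    tendsto_one_div_add_atTop_nhds_zero_nat hσ x

/-! ### Density of scalar ridge functions. -/

section Compact

variable {K : Type*} [TopologicalSpace K]
  {F : Type*} [NormedAddCommGroup F] [NormedSpace ℝ F]

/-- The function `x ↦ τ (u x + b)`. -/
def ridge {τ : ℝ → ℝ} (hτ : Continuous τ) (u : C(K, ℝ)) (b : ℝ) :
    C(K, ℝ) :=
  ⟨fun x => τ (u x + b), by fun_prop⟩

theorem continuous_ridge {τ : ℝ → ℝ} (hτ : Continuous τ) (u : C(K, ℝ)) :
    Continuous (ridge hτ u) :=
  ContinuousMap.continuous_of_continuous_uncurry _ <|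
    show Continuous fun p : ℝ × K => τ (u p.2 + p.1) by fun_prop

variable [CompactSpace K]

/-- A mollified ridge is a `C(K, ℝ)`-valued Bochner integral of translated ridges of `σ`, and `L`
commutes with the integral. -/
theorem map_ridge_mollify_eq_zero [CompleteSpace F] (L : C(K, ℝ) →L[ℝ] F)
    {σ : ℝ → ℝ} (hσ : Continuous σ) {u : C(K, ℝ)} (h : ∀ b, L (ridge hσ u b) = 0) (φ : ContDiffBump (0 : ℝ))
    (hτ : Continuous (mollify φ σ)) (b : ℝ) : L (ridge hτ u b) = 0 := by
  let I : ℝ → C(K, ℝ) := fun t => φ.normed volume t • ridge hσ u (b - t)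
  have hI : Integrable I := by
    refine Continuous.integrable_of_hasCompactSupport ?_ ?_
    · exact φ.continuous_normed.smul ((continuous_ridge hσ u).comp (by fun_prop))
    · exact φ.hasCompactSupport_normed.smul_right
  have hint : ridge hτ u b = ∫ t, I t := by
    ext x
    have := (ContinuousMap.evalCLM ℝ x : C(K, ℝ) →L[ℝ] ℝ).integral_comp_comm hI
    change _ = ContinuousMap.evalCLM ℝ x (∫ t, I t)
    rw [← this]
    change ∫ t, _ = ∫ t, _
    refine integral_congr_ae (Eventually.of_forall fun t => ?_)
    simp [I, ridge, add_sub_assoc]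
  rw [hint, ← L.integral_comp_comm hI]
  simp [I, h]

/-- Differentiating `s ↦ L (τ (s u + b))` repeatedly at `0`. -/
theorem map_pow_eq_zero_of_ridge (L : C(K, ℝ) →L[ℝ] F) {τ : ℝ → ℝ} {n : ℕ} (hτ : ContDiff ℝ n τ)
    (u : C(K, ℝ)) (b : ℝ) (h : ∀ s : ℝ, L (ridge hτ.continuous (s • u) b) = 0)
    (hb : iteratedDeriv n τ b ≠ 0) : L (u ^ n) = 0 := by
  have hcont : ∀ j ≤ n, Continuous (iteratedDeriv j τ) := fun j hj =>
    hτ.continuous_iteratedDeriv j (by exact_mod_cast hj)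
  -- The argument of `L` is the `j`-th derivative in `s` of `τ (s u + b)`.
  have key : ∀ j (hj : j ≤ n) (s : ℝ), L (u ^ j * ridge (hcont j hj) (s • u) b) = 0 := by
    intro j
    induction j with
    | zero =>
      intro hj s
      rw [pow_zero, one_mul, ← h s]
      congr 1
    | succ j ih =>
      intro hj s
      let E : ∀ i, i ≤ n → ℝ → C(K, ℝ) := fun i hi s => u ^ i * ridge (hcont i hi) (s • u) b
      have hE : Continuous (E (j + 1) hj) := by
        refine ContinuousMap.continuous_of_continuous_uncurry _ ?_
        have := hcont _ hj
        change Continuous fun p : ℝ × K => u p.2 ^ (j + 1) * iteratedDeriv (j + 1) τ (p.1 * u p.2 + b)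
        fun_prop
      -- Writing the curve as an integral upgrades pointwise derivatives to differentiability in the
      -- sup norm.
      have hFTC : ∀ s, E j (by lia) s = E j (by lia) 0 + ∫ t in (0 : ℝ)..s, E (j + 1) hj t := by
        intro s
        ext x
        have h1 := (ContinuousMap.evalCLM ℝ x : C(K, ℝ) →L[ℝ] ℝ).intervalIntegral_comp_comm
          (hE.intervalIntegrable (μ := volume) 0 s)
        change _ = _ + ContinuousMap.evalCLM ℝ x (∫ t in (0 : ℝ)..s, E (j + 1) hj t)
        rw [← h1]
        have h2 : ∀ t : ℝ, HasDerivAt (fun t => E j (by lia) t x) (E (j + 1) hj t x) t := by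
          intro t
          have hd : HasDerivAt (iteratedDeriv j τ) (iteratedDeriv (j + 1) τ (t * u x + b))
              (t * u x + b) := by
            rw [iteratedDeriv_succ]
            exact (hτ.differentiable_iteratedDeriv j (by exact_mod_cast hj) _).hasDerivAt
          have hl : HasDerivAt (fun t => t * u x + b) (u x) t := by
            simpa using ((hasDerivAt_id t).mul_const (u x)).add_const b
          have := (hd.comp t hl).const_mul (u x ^ j)
          refine this.congr_deriv ?_
          change _ = u x ^ (j + 1) * iteratedDeriv (j + 1) τ (t * u x + b)
          ring
        have h3 := intervalIntegral.integral_eq_sub_of_hasDerivAt (a := 0) (b := s)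
          (fun t _ => h2 t) (Continuous.intervalIntegrable
            ((ContinuousMap.evalCLM ℝ x : C(K, ℝ) →L[ℝ] ℝ).continuous.comp hE) _ _)
        change _ = _ + ∫ t in (0 : ℝ)..s, E (j + 1) hj t x
        rw [h3]
        simp
      have hder : HasDerivAt (fun s => L (E j (by lia) s)) (L (E (j + 1) hj s)) s := by
        refine L.hasFDerivAt.comp_hasDerivAt s ?_
        rw [funext hFTC]
        exact (intervalIntegral.integral_hasDerivAt_right (hE.intervalIntegrable _ _)
          (hE.stronglyMeasurableAtFilter _ _) hE.continuousAt).const_add _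
      rw [show (fun s => L (E j (by lia) s)) = fun _ => 0 from funext fun s => ih (by lia) s] at hder
      exact hder.unique (hasDerivAt_const s 0)
  -- At `s = 0` the ridge factor is the nonzero constant `iteratedDeriv n τ b`.
  have h0 := key n le_rfl 0
  have : u ^ n * ridge (hcont n le_rfl) ((0 : ℝ) • u) b = iteratedDeriv n τ b • u ^ n := by
    ext x
    simp [ridge, mul_comm]
  rw [this, map_smul] at h0
  exact (smul_eq_zero.1 h0).resolve_left hb

open NormedSpace in
/-- The exponentials of a point-separating space of functions span a dense space. -/
theorem eq_zero_of_map_exp_eq_zero (L : C(K, ℝ) →L[ℝ] F) (A : Submodule ℝ C(K, ℝ))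
    (hA : ∀ x y, x ≠ y → ∃ u ∈ A, u x ≠ u y) (h : ∀ u ∈ A, L (exp u) = 0) : L = 0 := by
  -- Since `exp u * exp w = exp (u + w)`, the linear span of the exponentials is already an algebra.
  let S : Submonoid C(K, ℝ) :=
    { carrier := {f | ∃ u ∈ A, f = exp u}
      one_mem' := ⟨0, A.zero_mem, exp_zero.symm⟩
      mul_mem' := by
        rintro _ _ ⟨u, hu, rfl⟩ ⟨w, hw, rfl⟩
        exact ⟨u + w, A.add_mem hu hw, exp_add.symm⟩ }
  have hexp : ∀ (u : C(K, ℝ)) (x : K), exp u x = Real.exp (u x) := by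
    intro u x
    have := NormedSpace.map_exp (ContinuousMap.evalAlgHom ℝ ℝ x : C(K, ℝ) →ₐ[ℝ] ℝ)
      (ContinuousMap.evalCLM ℝ x : C(K, ℝ) →L[ℝ] ℝ).continuous u
    rw [Real.exp_eq_exp_ℝ]
    exact this
  have hdense := ContinuousMap.subalgebra_topologicalClosure_eq_top_of_separatesPoints
    (Algebra.adjoin ℝ (S : Set C(K, ℝ))) (by
      intro x y hxy
      obtain ⟨u, hu, hne⟩ := hA x y hxy
      refine ⟨_, ⟨exp u, Algebra.subset_adjoin ⟨u, hu, rfl⟩, rfl⟩, ?_⟩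
      change exp u x ≠ exp u y
      rw [hexp, hexp]
      exact fun he => hne (Real.exp_injective he))
  have hker : (Algebra.adjoin ℝ (S : Set C(K, ℝ)) : Set C(K, ℝ)) ⊆ L.ker := by
    intro f hf
    have : f ∈ Submodule.span ℝ (S : Set C(K, ℝ)) := by
      have h1 := Algebra.adjoin_eq_span (R := ℝ) (S : Set C(K, ℝ))
      rw [Submonoid.closure_eq] at h1
      rw [← h1]
      exact hf
    refine Submodule.span_le.2 ?_ this
    rintro _ ⟨u, hu, rfl⟩
    exact h u hu
  ext1 f
  have hf : f ∈ closure (Algebra.adjoin ℝ (S : Set C(K, ℝ)) : Set C(K, ℝ)) := by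
    rw [← Subalgebra.topologicalClosure_coe, hdense]
    trivial
  exact closure_minimal hker L.isClosed_ker hf

/-- Universality of shallow networks on a compact space: if the functions in `A` separate points
and `σ` is not a polynomial, then the functions `σ ∘ (u + b)` with `u ∈ A` span a dense space. -/
theorem topologicalClosure_span_ridge_eq_top_of_compactSpace {σ : ℝ → ℝ} (hσ : Continuous σ)
    (hpoly : ¬ ∃ p : Polynomial ℝ, ∀ t : ℝ, σ t = p.eval t) (A : Submodule ℝ C(K, ℝ))
    (hA : ∀ x y, x ≠ y → ∃ u ∈ A, u x ≠ u y) :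
    (Submodule.span ℝ {f | ∃ u ∈ A, ∃ b, f = ridge hσ u b}).topologicalClosure = ⊤ := by
  set S := (Submodule.span ℝ {f | ∃ u ∈ A, ∃ b, f = ridge hσ u b}).topologicalClosure with hS
  have : IsClosed (S : Set C(K, ℝ)) := Submodule.isClosed_topologicalClosure _
  have hL : S.mkQL = 0 := by
    have hridge : ∀ u ∈ A, ∀ b, S.mkQL (ridge hσ u b) = 0 := fun u hu b =>
      (Submodule.Quotient.mk_eq_zero S).2 <|
        Submodule.le_topologicalClosure _ (Submodule.subset_span ⟨u, hu, b, rfl⟩)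
    refine eq_zero_of_map_exp_eq_zero (F := C(K, ℝ) ⧸ S) S.mkQL A hA fun u hu => ?_
    have hpow : ∀ n : ℕ, S.mkQL (u ^ n) = 0 := by
      intro n
      -- The mollifier and the base point may depend on `n`; no single choice has to serve every
      -- power.
      obtain ⟨φ, b, hb⟩ := exists_iteratedDeriv_mollify_ne_zero hσ hpoly n
      exact map_pow_eq_zero_of_ridge (F := C(K, ℝ) ⧸ S) S.mkQL (contDiff_mollify φ hσ n) u b
        (fun s => map_ridge_mollify_eq_zero (F := C(K, ℝ) ⧸ S) S.mkQL hσ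
          (hridge _ (A.smul_mem s hu)) φ _ b) hb
    have hsum := S.mkQL.hasSum (NormedSpace.exp_series_hasSum_exp' (𝕂 := ℝ) u)
    simp only [map_smul, hpow, smul_zero] at hsum
    exact hsum.unique hasSum_zero
  rw [eq_top_iff]
  intro f _
  exact (Submodule.Quotient.mk_eq_zero S).1 (DFunLike.congr_fun hL f)

end Compact

/-- A linear space of continuous functions is dense in the compact-open topology once its
restrictions to all compact sets are dense. -/
theorem topologicalClosure_eq_top_of_restrict {V : Type*} [TopologicalSpace V]
    (S : Submodule ℝ C(V, ℝ))
    (h : ∀ K : Set V, IsCompact K → Dense (ContinuousMap.restrict K '' (S : Set C(V, ℝ)))) :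
    S.topologicalClosure = ⊤ := by
  rw [eq_top_iff]
  intro f _
  change f ∈ closure (S : Set C(V, ℝ))
  rw [mem_closure_iff_nhds_basis
    (nhds_basis_uniformity Metric.uniformity_basis_dist.compactConvergenceUniformity)]
  rintro ⟨K, ε⟩ ⟨hK, hε⟩
  have := isCompact_iff_compactSpace.1 hK
  obtain ⟨_, ⟨g, hg, rfl⟩, hgf⟩ := Metric.mem_closure_iff.1 (h K hK (f.restrict K)) ε hε
  refine ⟨g, hg, fun x hx => ?_⟩
  rw [dist_comm] at hgf
  exact (ContinuousMap.dist_lt_iff hε).1 hgf ⟨x, hx⟩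

/-- Universality of shallow networks in the compact-open topology: if the functions in `A` separate
points and `σ` is not a polynomial, then the functions `σ ∘ (u + b)` with `u ∈ A` span a dense
space. -/
theorem topologicalClosure_span_ridge_eq_top {V : Type*} [TopologicalSpace V]
    {σ : ℝ → ℝ} (hσ : Continuous σ)
    (hpoly : ¬ ∃ p : Polynomial ℝ, ∀ t : ℝ, σ t = p.eval t) (A : Submodule ℝ C(V, ℝ))
    (hA : ∀ x y, x ≠ y → ∃ u ∈ A, u x ≠ u y) :
    (Submodule.span ℝ {f | ∃ u ∈ A, ∃ b, f = ridge hσ u b}).topologicalClosure = ⊤ := by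
  refine topologicalClosure_eq_top_of_restrict _ fun K hK => ?_
  have := isCompact_iff_compactSpace.1 hK
  let R : C(V, ℝ) →ₗ[ℝ] C(K, ℝ) :=
    { toFun := ContinuousMap.restrict K
      map_add' := fun _ _ => rfl
      map_smul' := fun _ _ => rfl }
  have h := topologicalClosure_span_ridge_eq_top_of_compactSpace hσ hpoly (A.map R) (by
    intro x y hxy
    obtain ⟨u, hu, hne⟩ := hA x y (Subtype.coe_injective.ne hxy)
    exact ⟨R u, Submodule.mem_map_of_mem hu, hne⟩)
  rw [← Submodule.dense_iff_topologicalClosure_eq_top] at h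
  refine h.mono ?_
  change _ ⊆ R '' _
  rw [← Submodule.map_coe, Submodule.map_span]
  refine Submodule.span_mono ?_
  rintro _ ⟨_, ⟨u, hu, rfl⟩, b, rfl⟩
  exact ⟨_, ⟨u, hu, b, rfl⟩, rfl⟩

end Universality

/-! ### Shallow networks as a linear space. -/

section Networks

variable {X Y Z : Type*}

theorem affineMap_sum_apply {ι : Type*} (s : Finset ι) (f : ι → ((X → ℝ) →ᵃ[ℝ] (Y → ℝ)))
    (v : X → ℝ) : (∑ i ∈ s, f i) v = ∑ i ∈ s, f i v := by
  classical
  induction s using Finset.induction_on with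
  | empty => simp
  | insert i s hi ih => simp [Finset.sum_insert hi, ih]

theorem mem_neuralSpace_iff {σ : ℝ → ℝ} {M : Submodule ℝ ((X → ℝ) →ᵃ[ℝ] (Y → ℝ))}
    {N : Submodule ℝ ((Y → ℝ) →ᵃ[ℝ] (Z → ℝ))} {h : ℕ} {F : (X → ℝ) → (Z → ℝ)} :
    F ∈ neuralSpace σ (widenOut M h) (widenIn N h) ↔
      ∃ (f : Fin h → ((X → ℝ) →ᵃ[ℝ] (Y → ℝ))) (g : Fin h → ((Y → ℝ) →ᵃ[ℝ] (Z → ℝ))),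
        (∀ i, f i ∈ M) ∧ (∀ i, g i ∈ N) ∧ ∀ v, F v = ∑ i, g i (pointwise σ (f i v)) := by
  constructor
  · rintro ⟨η, ⟨f, hf, hη⟩, φ, ⟨g, hg, hφ⟩, rfl⟩
    refine ⟨f, g, hf, hg, fun v => ?_⟩
    simp only [hφ, pointwise, hη]
    rfl
  · rintro ⟨f, g, hf, hg, hF⟩
    refine ⟨AffineMap.pi fun p => (AffineMap.proj p.1).comp (f p.2),
      ⟨f, hf, fun _ _ _ => rfl⟩,
      ∑ i, (g i).comp (LinearMap.funLeft ℝ ℝ fun y => (y, i)).toAffineMap,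
      ⟨g, hg, fun w => ?_⟩, funext fun v => ?_⟩
    · simp only [affineMap_sum_apply]
      rfl
    · simp only [hF, affineMap_sum_apply]
      rfl

/-- The shallow networks with layers in `M` and `N` form a linear space. -/
def networks (σ : ℝ → ℝ) (M : Submodule ℝ ((X → ℝ) →ᵃ[ℝ] (Y → ℝ)))
    (N : Submodule ℝ ((Y → ℝ) →ᵃ[ℝ] (Z → ℝ))) : Submodule ℝ C(X → ℝ, Z → ℝ) where
  carrier := {F | ∃ h : ℕ, (F : (X → ℝ) → (Z → ℝ)) ∈ neuralSpace σ (widenOut M h) (widenIn N h)}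
  zero_mem' := ⟨0, mem_neuralSpace_iff.2
    ⟨Fin.elim0, Fin.elim0, fun i => i.elim0, fun i => i.elim0, fun _ => by simp⟩⟩
  add_mem' := by
    rintro F F' ⟨h, hF⟩ ⟨h', hF'⟩
    obtain ⟨f, g, hf, hg, hF⟩ := mem_neuralSpace_iff.1 hF
    obtain ⟨f', g', hf', hg', hF'⟩ := mem_neuralSpace_iff.1 hF'
    refine ⟨h + h', mem_neuralSpace_iff.2
      ⟨Fin.append f f', Fin.append g g', fun i => ?_, fun i => ?_, fun v => ?_⟩⟩
    · refine Fin.addCases (fun i => ?_) (fun i => ?_) i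
      · simpa using hf i
      · simpa using hf' i
    · refine Fin.addCases (fun i => ?_) (fun i => ?_) i
      · simpa using hg i
      · simpa using hg' i
    · simp [Fin.sum_univ_add, hF, hF']
  smul_mem' := by
    rintro c F ⟨h, hF⟩
    obtain ⟨f, g, hf, hg, hF⟩ := mem_neuralSpace_iff.1 hF
    refine ⟨h, mem_neuralSpace_iff.2
      ⟨f, fun i => c • g i, hf, fun i => N.smul_mem c (hg i), fun v => ?_⟩⟩
    simp [hF, Finset.smul_sum]

theorem mem_networks {σ : ℝ → ℝ} {M : Submodule ℝ ((X → ℝ) →ᵃ[ℝ] (Y → ℝ))}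
    {N : Submodule ℝ ((Y → ℝ) →ᵃ[ℝ] (Z → ℝ))} {F : C(X → ℝ, Z → ℝ)} :
    F ∈ networks σ M N ↔
      ∃ (h : ℕ) (f : Fin h → ((X → ℝ) →ᵃ[ℝ] (Y → ℝ))) (g : Fin h → ((Y → ℝ) →ᵃ[ℝ] (Z → ℝ))),
        (∀ i, f i ∈ M) ∧ (∀ i, g i ∈ N) ∧ ∀ v, F v = ∑ i, g i (pointwise σ (f i v)) :=
  exists_congr fun _ => mem_neuralSpace_iff

end Networks

/-! ### Equivariance and averaging over `H`. -/

section Equivariant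

variable {G X Y Z : Type*} [Group G] [MulAction G X] [MulAction G Y] [MulAction G Z]

theorem permRep_permRep (g k : G) (v : X → ℝ) :
    permRep G X g (permRep G X k v) = permRep G X (g * k) v := by
  rw [map_mul]
  rfl

theorem continuous_permRep (g : G) : Continuous (permRep G X g) :=
  continuous_pi fun x => continuous_apply (g⁻¹ • x)

theorem isClosed_continuousEquivariant : IsClosed (continuousEquivariant G X Z) := by
  have : continuousEquivariant G X Z =
      ⋂ (g : G) (v : X → ℝ), {f | f (permRep G X g v) = permRep G Z g (f v)} := by
    ext f
    simp [continuousEquivariant]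
  rw [this]
  exact isClosed_iInter fun g => isClosed_iInter fun v =>
    isClosed_eq (ContinuousEvalConst.continuous_eval_const _)
      ((continuous_permRep g).comp (ContinuousEvalConst.continuous_eval_const v))

theorem fullUniversalityClass_subset_continuousEquivariant (σ : ℝ → ℝ) :
    fullUniversalityClass G X Y Z σ ⊆ continuousEquivariant G X Z := by
  refine closure_minimal (fun F hF => ?_) isClosed_continuousEquivariant
  obtain ⟨h, f, g, hf, hg, hF⟩ := mem_networks.1 hF
  intro k v
  simp only [hF, map_sum]
  refine Finset.sum_congr rfl fun i _ => ?_
  rw [hf i k v, ← hg i k]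
  rfl

/-- The average of a vector over the subgroup `H`. -/
noncomputable def average (X : Type*) [MulAction G X] (H : Subgroup G) [Fintype H] :
    (X → ℝ) →ₗ[ℝ] (X → ℝ) :=
  (Fintype.card H : ℝ)⁻¹ • ∑ h : H, permRep G X h

theorem average_apply (H : Subgroup G) [Fintype H] (v : X → ℝ) :
    average X H v = (Fintype.card H : ℝ)⁻¹ • ∑ h : H, permRep G X h v := by
  simp [average]

theorem average_permRep_of_mem (H : Subgroup G) [Fintype H] {h : G} (hh : h ∈ H) (v : X → ℝ) :
    average X H (permRep G X h v) = average X H v := by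
  rw [average_apply, average_apply]
  congr 1
  refine Fintype.sum_equiv (Equiv.mulRight ⟨h, hh⟩) _ _ fun k => ?_
  simp [map_mul]

theorem average_permRep_inv_eq (H : Subgroup G) [Fintype H] {g k : G} (h : (g : G ⧸ H) = k)
    (v : X → ℝ) : average X H (permRep G X g⁻¹ v) = average X H (permRep G X k⁻¹ v) := by
  have hmem : k⁻¹ * g ∈ H := QuotientGroup.eq.1 h.symm
  rw [← average_permRep_of_mem H hmem (permRep G X g⁻¹ v), permRep_permRep]
  simp

theorem continuous_average [Finite X] (H : Subgroup G) [Fintype H] : Continuous (average X H) :=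
  (average X H).continuous_of_finiteDimensional

/-- A normal subgroup `H` acts trivially on `ℝ^(G/H)`, so that equivariant affine maps into it do
not change when their argument is averaged over `H`. -/
theorem affEquiv_average (H : Subgroup G) [H.Normal] [Fintype H]
    {f : (X → ℝ) →ᵃ[ℝ] (G ⧸ H → ℝ)} (hf : f ∈ affEquiv G X (G ⧸ H)) (v : X → ℝ) :
    f (average X H v) = f v := by
  have htriv : ∀ (h : H) (w : G ⧸ H → ℝ), permRep G (G ⧸ H) h w = w := by
    intro h w
    ext k
    induction k using QuotientGroup.induction_on with
    | H k =>
      change w (((h : G)⁻¹ * k : G) : G ⧸ H) = w k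
      congr 1
      refine (QuotientGroup.eq.2 ?_).symm
      have := Subgroup.Normal.conj_mem ‹H.Normal› _ (H.inv_mem h.2) k⁻¹
      simpa [mul_assoc] using this
  -- The constant term of `f` cancels from `f (h v) = f v`.
  have hlin : ∀ h : H, f.linear (permRep G X h v) = f.linear v := by
    intro h
    have h1 := hf h v
    rw [htriv, AffineMap.decomp f] at h1
    simpa using h1
  rw [AffineMap.decomp f]
  simp [average_apply, hlin, ← Nat.cast_smul_eq_nsmul ℝ, smul_smul]

theorem networks_average (H : Subgroup G) [H.Normal] [Fintype H] {σ : ℝ → ℝ}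
    {F : C(X → ℝ, Z → ℝ)} (hF : F ∈ networks σ (affEquiv G X (G ⧸ H)) (affEquiv G (G ⧸ H) Z))
    (v : X → ℝ) : F (average X H v) = F v := by
  obtain ⟨h, f, g, hf, hg, hF⟩ := mem_networks.1 hF
  simp only [hF, affEquiv_average H (hf _)]

theorem fullUniversalityClass_average (H : Subgroup G) [H.Normal] [Fintype H] {σ : ℝ → ℝ}
    {F : C(X → ℝ, Z → ℝ)} (hF : F ∈ fullUniversalityClass G X (G ⧸ H) Z σ)
    (v : X → ℝ) : F (average X H v) = F v := by
  have hclosed : IsClosed {F : C(X → ℝ, Z → ℝ) | F (average X H v) = F v} :=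
    isClosed_eq (ContinuousEvalConst.continuous_eval_const _)
      (ContinuousEvalConst.continuous_eval_const _)
  exact closure_minimal (fun F hF => networks_average H hF v) hclosed hF

end Equivariant

/-! ### Lifting scalar density to equivariant maps. -/

section Density

variable {G X Y : Type*} [Group G] [MulAction G X] [MulAction G Y]

/-- The equivariant affine map `ℝ^X → ℝ^(G/H)` whose coordinate at `gH` is
`v ↦ l (average (g⁻¹ v)) + b`. -/
noncomputable def cosetLayer (H : Subgroup G) [Fintype H] (l : (X → ℝ) →ₗ[ℝ] ℝ) (b : ℝ) :
    (X → ℝ) →ᵃ[ℝ] (G ⧸ H → ℝ) :=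
  (LinearMap.pi fun k : G ⧸ H => l ∘ₗ average X H ∘ₗ permRep G X k.out⁻¹).toAffineMap +
    AffineMap.const ℝ _ fun _ => b

theorem cosetLayer_apply (H : Subgroup G) [Fintype H] (l : (X → ℝ) →ₗ[ℝ] ℝ) (b : ℝ)
    (v : X → ℝ) (g : G) :
    cosetLayer H l b v g = l (average X H (permRep G X g⁻¹ v)) + b := by
  -- Averaging over `H` makes the choice of coset representative irrelevant.
  rw [← average_permRep_inv_eq H (QuotientGroup.out_eq' (g : G ⧸ H)) v]
  simp [cosetLayer]

theorem cosetLayer_mem (H : Subgroup G) [Fintype H] (l : (X → ℝ) →ₗ[ℝ] ℝ) (b : ℝ) :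
    cosetLayer H l b ∈ affEquiv G X (G ⧸ H) := by
  intro k v
  ext c
  induction c using QuotientGroup.induction_on with
  | H g =>
    change _ = cosetLayer H l b v ((k⁻¹ * g : G) : G ⧸ H)
    rw [cosetLayer_apply, cosetLayer_apply, permRep_permRep]
    simp

variable [Fintype G] [DecidableEq Y]

/-- The equivariant linear map `ℝ^(G/H) → ℝ^Y` that sends `e_(gH)` to the sum of the `e_(g h y)`
with `h ∈ H`. -/
noncomputable def cosetLift (H : Subgroup G) (y : Y) : (G ⧸ H → ℝ) →ₗ[ℝ] (Y → ℝ) :=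
  ∑ g : G, (LinearMap.proj (g : G ⧸ H)).smulRight (Pi.single (g • y) 1)

theorem cosetLift_apply (H : Subgroup G) (y : Y) (w : G ⧸ H → ℝ) :
    cosetLift H y w = ∑ g : G, w g • (Pi.single (g • y) 1 : Y → ℝ) := by
  simp [cosetLift]

theorem cosetLift_mem (H : Subgroup G) (y : Y) :
    (cosetLift H y).toAffineMap ∈ affEquiv G (G ⧸ H) Y := by
  intro k w
  simp only [LinearMap.coe_toAffineMap, cosetLift_apply, map_sum, map_smul, permRep_single]
  symm
  refine Fintype.sum_equiv (Equiv.mulLeft k) _ _ fun g => ?_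
  simp only [Equiv.coe_mulLeft, mul_smul]
  congr 1
  change w g = w ((k⁻¹ * (k * g) : G) : G ⧸ H)
  rw [inv_mul_cancel_left]

/-- The map sending a function `F` to `v ↦ ∑ g, F (average (g⁻¹ v)) e_(g y)`. -/
noncomputable def symmetrize [Finite X] (H : Subgroup G) [Fintype H] (y : Y) :
    C(X → ℝ, ℝ) →L[ℝ] C(X → ℝ, Y → ℝ) :=
  ∑ g : G,
    ((ContinuousLinearMap.toSpanSingleton ℝ (Pi.single (g • y) 1 : Y → ℝ)).compLeftContinuous
      ℝ (X → ℝ)).comp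
    ({toFun := fun F => F.comp
        ⟨fun v => average X H (permRep G X g⁻¹ v),
          (continuous_average H).comp (continuous_permRep _)⟩
      map_add' := fun _ _ => rfl
      map_smul' := fun _ _ => rfl
      cont := ContinuousMap.continuous_precomp _ } : C(X → ℝ, ℝ) →L[ℝ] C(X → ℝ, ℝ))

theorem symmetrize_apply [Finite X] (H : Subgroup G) [Fintype H] (y : Y) (F : C(X → ℝ, ℝ))
    (v : X → ℝ) :
    symmetrize H y F v =
      ∑ g : G, F (average X H (permRep G X g⁻¹ v)) • (Pi.single (g • y) 1 : Y → ℝ) := by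
  simp [symmetrize, ContinuousMap.sum_apply]

/-- The hidden coordinate at `gH` is `σ (l (average (g⁻¹ v)) + b)`, exactly the coefficient of `e_(g
y)`, so one channel suffices. -/
theorem symmetrize_ridge_mem [Finite X] (H : Subgroup G) [Fintype H] (y : Y) {σ : ℝ → ℝ}
    (hσ : Continuous σ) {u : C(X → ℝ, ℝ)} {l : (X → ℝ) →ₗ[ℝ] ℝ} (hu : ∀ v, u v = l v) (b : ℝ) :
    symmetrize H y (ridge hσ u b) ∈
      networks σ (affEquiv G X (G ⧸ H)) (affEquiv G (G ⧸ H) Y) := by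
  refine mem_networks.2 ⟨1, fun _ => cosetLayer H l b, fun _ => (cosetLift H y).toAffineMap,
    fun _ => cosetLayer_mem H l b, fun _ => cosetLift_mem H y, fun v => ?_⟩
  simp [symmetrize_apply, cosetLift_apply, pointwise, cosetLayer_apply, ridge, hu]

/-- For each fixed `g`, the sum over `y` is `g (f (g⁻¹ v)) = f v`; there are `|G|` such terms. -/
theorem sum_symmetrize [Finite X] [Fintype Y] (H : Subgroup G) [Fintype H] {f : C(X → ℝ, Y → ℝ)}
    (hf : f ∈ continuousEquivariant G X Y) (hH : ∀ v, f (average X H v) = f v) :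
    ∑ y, symmetrize H y ((ContinuousMap.eval y).comp f) = (Fintype.card G : ℝ) • f := by
  ext1 v
  have hexpand : ∀ w : Y → ℝ, ∑ y, w y • (Pi.single y 1 : Y → ℝ) = w := fun w => by
    ext y
    simp [Finset.sum_apply, Pi.single_apply]
  have hterm : ∀ g : G,
      ∑ y, f (average X H (permRep G X g⁻¹ v)) y • (Pi.single (g • y) 1 : Y → ℝ) = f v := by
    intro g
    simp only [← permRep_single, ← map_smul, ← map_sum, hexpand, hH]
    rw [← hf, permRep_permRep, mul_inv_cancel, map_one]
    rfl
  rw [ContinuousMap.sum_apply]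
  simp only [symmetrize_apply]
  rw [Finset.sum_comm]
  refine (Finset.sum_congr rfl fun g _ => hterm g).trans ?_
  simp [← Nat.cast_smul_eq_nsmul ℝ]

/-- A continuous equivariant map that does not change when its argument is averaged over `H` is a
limit of networks. -/
theorem mem_fullUniversalityClass [Finite X] [Fintype Y] (H : Subgroup G) [Fintype H]
    {σ : ℝ → ℝ} (hσ : Continuous σ)
    (hpoly : ¬ ∃ p : Polynomial ℝ, ∀ t : ℝ, σ t = p.eval t) {f : C(X → ℝ, Y → ℝ)}
    (hf : f ∈ continuousEquivariant G X Y) (hH : ∀ v, f (average X H v) = f v) :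
    f ∈ fullUniversalityClass G X (G ⧸ H) Y σ := by
  let A : Submodule ℝ C(X → ℝ, ℝ) :=
    { carrier := {u | ∃ l : (X → ℝ) →ₗ[ℝ] ℝ, ∀ v, u v = l v}
      zero_mem' := ⟨0, fun _ => rfl⟩
      add_mem' := by
        rintro u w ⟨l, hl⟩ ⟨m, hm⟩
        exact ⟨l + m, fun v => by simp [hl, hm]⟩
      smul_mem' := by
        rintro c u ⟨l, hl⟩
        exact ⟨c • l, fun v => by simp [hl]⟩ }
  have hA : ∀ x y, x ≠ y → ∃ u ∈ A, u x ≠ u y := fun v w hvw =>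
    (Function.ne_iff.1 hvw).imp' (fun x => ContinuousMap.eval x)
      fun x hx => ⟨⟨LinearMap.proj x, fun _ => rfl⟩, hx⟩
  have htop := topologicalClosure_span_ridge_eq_top hσ hpoly A hA
  set S := (networks σ (affEquiv G X (G ⧸ H)) (affEquiv G (G ⧸ H) Y)).topologicalClosure
  have hmem : ∀ (y : Y) (F : C(X → ℝ, ℝ)), symmetrize H y F ∈ S := by
    intro y F
    have hF : F ∈ closure (Submodule.span ℝ {f | ∃ u ∈ A, ∃ b, f = ridge hσ u b} : Set _) := by
      rw [← Submodule.topologicalClosure_coe, htop]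
      trivial
    refine map_mem_closure (symmetrize H y).continuous hF ?_
    refine fun F hF => Submodule.span_le (p := (networks σ _ _).comap
      (symmetrize H y).toLinearMap).2 ?_ hF
    rintro _ ⟨u, ⟨l, hl⟩, b, rfl⟩
    exact symmetrize_ridge_mem H y hσ hl b
  change f ∈ S
  rw [← inv_smul_smul₀ (Nat.cast_ne_zero.2 Fintype.card_ne_zero : (Fintype.card G : ℝ) ≠ 0) f,
    ← sum_symmetrize H hf hH]
  exact S.smul_mem _ (S.sum_mem fun y _ => hmem y _)

end Density

end EquivNet

theorem mainTheorem5 {G : Type*} [Group G] [Finite G] (H : Subgroup G) [H.Normal]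
    {X Y : Type*} [Finite X] [Finite Y] [MulAction G X] [MulAction G Y]
    (σ : ℝ → ℝ) (hσ : Continuous σ) (hσ_poly : ¬ ∃ p : Polynomial ℝ, ∀ t : ℝ, σ t = p.eval t) :
    EquivNet.IsSeparationConstrainedUniversal (EquivNet.continuousEquivariant G X Y)
        (EquivNet.fullUniversalityClass G X (G ⧸ H) Y σ) ∧
      ((∀ (g : G) (y : Y), g • y = y) →
        EquivNet.IsSeparationConstrainedUniversal Set.univ
          (EquivNet.fullUniversalityClass G X (G ⧸ H) Y σ)) := by
  classical
  have := Fintype.ofFinite G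
  have := Fintype.ofFinite H
  have := Fintype.ofFinite Y
  have hclosure : closure (EquivNet.fullUniversalityClass G X (G ⧸ H) Y σ) =
      EquivNet.fullUniversalityClass G X (G ⧸ H) Y σ := isClosed_closure.closure_eq
  have hequiv := EquivNet.fullUniversalityClass_subset_continuousEquivariant
    (G := G) (X := X) (Y := G ⧸ H) (Z := Y) σ
  have hmain : EquivNet.IsSeparationConstrainedUniversal (EquivNet.continuousEquivariant G X Y)
      (EquivNet.fullUniversalityClass G X (G ⧸ H) Y σ) := by
    unfold EquivNet.IsSeparationConstrainedUniversal
    rw [hclosure]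
    refine Set.Subset.antisymm (fun f hf => ⟨hequiv hf, fun p hp => hp f hf⟩) ?_
    rintro f ⟨hf, hsep⟩
    exact EquivNet.mem_fullUniversalityClass H hσ hσ_poly hf fun v =>
      -- The only pairs of ρ needed are (average of `v`, `v`).
      hsep (_, v) fun F hF => EquivNet.fullUniversalityClass_average H hF v
  refine ⟨hmain, fun htriv => ?_⟩
  unfold EquivNet.IsSeparationConstrainedUniversal at hmain ⊢
  rw [hmain]
  refine Set.ext fun f => ⟨fun hf => ⟨trivial, hf.2⟩, fun hf => ⟨fun g v => ?_, hf.2⟩⟩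
  have hrep : ∀ w : Y → ℝ, EquivNet.permRep G Y g w = w := fun w =>
    funext fun y => congrArg w (htriv g⁻¹ y)
  rw [hrep]
  -- With trivial action on `Y`, the pair `(g v, v)` lies in ρ, so respecting ρ already forces
  -- invariance.
  exact hf.2 (_, v) fun F hF => (hequiv hF g v).trans (hrep _)
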